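/- All graphs are finite and simple. For graphs $H$ and $G$, let $t_H(G)=h_H(G)/|V(G)|^{|V(H)|}$, where $h_H(G)$ is the number of graph homomorphisms from $H$ to $G$. For $0<p<1$, a sequence $(G_n)$ of graphs is called quasirandom with density $p$ if $t_F(G_n)=(1+o(1))p^{|E(F)|}$ as $n\to\infty$ for every graph $F$. A graph $H$ is called forcing if, for every $0<p<1$, every sequence $(G_n)$ of graphs with $t_{K_2}(G_n)=(1+o(1))p$ and $t_H(G_n)=(1+o(1))p^{|E(H)|}$ is quasirandom with density $p$. **Theorem.** Let $H$ be a bipartite graph with parts $V_1,V_2$ such that $|V_2|\ge 2$ and there are two distinct vertices in $V_1$ each of which is adjacent to every vertex of $V_2$. Then $H$ is forcing. -/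

import Mathlib

open Filter
open scoped Asymptotics

universe u v

/-- The homomorphism density `t_H(G) = h_H(G) / |G|^|H|`: the fraction of all maps
`V(H) → V(G)` that are graph homomorphisms. -/
noncomputable def homDensity {W : Type u} {V : Type v} [Fintype W] [Fintype V]
    (H : SimpleGraph W) (G : SimpleGraph V) : ℝ :=
  (Nat.card (H →g G) : ℝ) / (Fintype.card V : ℝ) ^ Fintype.card W

/-- `t_H(G_n) = (1 + o(1)) p ^ |E(H)|` as `n → ∞`. -/
def HasRandomDensity {W : Type u} [Fintype W] (H : SimpleGraph W)
    {V : ℕ → Type v} [∀ n, Fintype (V n)] (G : ∀ n, SimpleGraph (V n)) (p : ℝ) : Prop :=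
  (fun n => homDensity H (G n)) ~[atTop] (fun _ => p ^ H.edgeSet.ncard)

/-- The sequence `G` of finite graphs is quasirandom with density `p`: the estimate
`t_F(G_n) = (1 + o(1)) p ^ |E(F)|` holds for every finite graph `F` (up to isomorphism, every
graph on some `Fin k`). -/
def IsQuasirandom {V : ℕ → Type v} [∀ n, Fintype (V n)] (G : ∀ n, SimpleGraph (V n))
    (p : ℝ) : Prop :=
  ∀ (k : ℕ) (F : SimpleGraph (Fin k)), HasRandomDensity F G p

/-- `H` is `p`-forcing: every sequence of finite graphs having the random density of `K₂` and
of `H` is quasirandom with density `p`. -/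
def IsPForcing {W : Type u} [Fintype W] (H : SimpleGraph W) (p : ℝ) : Prop :=
  ∀ (V : ℕ → Type v) [∀ n, Fintype (V n)] (G : ∀ n, SimpleGraph (V n)),
    HasRandomDensity (⊤ : SimpleGraph (Fin 2)) G p → HasRandomDensity H G p → IsQuasirandom G p

/-- `H` is forcing: it is `p`-forcing for all `0 < p < 1`. -/
def IsForcing {W : Type u} [Fintype W] (H : SimpleGraph W) : Prop :=
  ∀ p : ℝ, 0 < p → p < 1 → IsPForcing.{u, v} H p

/-! The proof is an entropy proof of Sidorenko's inequality that keeps its error terms. Let p be the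
edge density of the adjacency kernel, d(v) the normalized degree and k = |V₂|. A random star has a
centre v chosen proportionally to d(v), and k leaves, indexed by V₂, chosen independently among the
neighbours of v.

The density t_H is an average, over maps of V₂ into the graph, of a product of codegrees, one for
each vertex of H outside V₂. The codegree of the complete vertex `a` is itself an average over v,
and changing measure to the random star and applying Jensen bounds log t_H below by the star
expectation of log(p d(v)^(k-1)) plus the logarithms of the other codegrees. Gibbs' inequality
bounds each of these expectations below by |N(i)| log p; the second complete vertex `b` contributes
the relative entropy L of all the leaves as well. With D the relative entropy of the centre, the
outcome is log t_H ≥ e(H) log p + D + L (`entropy_le_log_expect_prod_codegree`).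

If t_H is asymptotically p^e(H), then D and L tend to 0. A Pinsker-type bound makes almost all
degrees close to p and the law of two leaves close to uniform; the density of that law is then
nearly codegree / p², so almost all codegrees are near p² (`codegreeDeviation_le`). Cauchy–Schwarz
turns this into a cut-norm bound, and replacing edges one at a time counts every graph F
(`abs_expect_prod_sub_pow_le`). -/

open Finset Function
open scoped BigOperators

/-! ### Averages over finite powers and entropy inequalities -/

section Averages

variable {α J V : Type*} [Fintype α] [Fintype J] [DecidableEq J] [Fintype V]

/-- Resampling one coordinate does not change an average over a finite power. -/
theorem expect_eq_expect_update (i : J) (h : (J → V) → ℝ) :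
    𝔼 x, h x = 𝔼 x, 𝔼 y, h (update x i y) := by
  rcases isEmpty_or_nonempty V with hV | hV
  · have : IsEmpty (J → V) := ⟨fun x => hV.elim (x i)⟩
    simp
  -- The involution exchanging coordinate `i` with the fresh sample preserves the uniform measure.
  let e : ((J → V) × V) ≃ ((J → V) × V) :=
    { toFun := fun z => (update z.1 i z.2, z.1 i)
      invFun := fun z => (update z.1 i z.2, z.1 i)
      left_inv := fun z => by simp
      right_inv := fun z => by simp }
  rw [← expect_product', univ_product_univ,
    Fintype.expect_equiv e (fun z => h (update z.1 i z.2)) (fun z => h z.1) (fun z => rfl),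
    ← univ_product_univ, expect_product]
  simp

theorem expect_apply_pair [Nonempty V] {i j : J} (hij : i ≠ j) (h : V → V → ℝ) :
    𝔼 x : J → V, h (x i) (x j) = 𝔼 y, 𝔼 z, h y z := by
  rw [expect_eq_expect_update i]
  simp only [update_self, update_of_ne hij.symm]
  rw [expect_comm]
  refine expect_congr rfl fun y _ => ?_
  rw [expect_eq_expect_update j]
  simp

/-- Coordinates on which `g` does not depend can be integrated out against a product density. -/
theorem expect_prod_mul_of_dependsOn [Nonempty V] (c : V → ℝ) (hc : 𝔼 y, c y = 1) (S : Finset J)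
    (g : (J → V) → ℝ) (hg : DependsOn g (S : Set J)) (T : Finset J) (hT : Disjoint S T) :
    𝔼 x, (∏ j ∈ T, c (x j)) * g x = 𝔼 x, g x := by
  induction T using Finset.induction_on with
  | empty => simp
  | insert i T hi ih =>
    rw [disjoint_insert_right] at hT
    rw [← ih hT.2, expect_eq_expect_update i]
    refine expect_congr rfl fun x _ => ?_
    have hterm : ∀ y, (∏ j ∈ insert i T, c (update x i y j)) * g (update x i y)
        = c y * ((∏ j ∈ T, c (x j)) * g x) := by
      intro y
      rw [prod_insert hi, update_self, mul_assoc]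
      congr 2
      · refine prod_congr rfl fun j hj => ?_
        rw [update_of_ne (ne_of_mem_of_not_mem hj hi)]
      · refine hg fun j hj => ?_
        rw [update_of_ne (ne_of_mem_of_not_mem (mem_coe.1 hj) hT.1)]
    simp only [hterm]
    rw [← expect_mul, hc, one_mul]

/-- Gibbs' inequality in the form `E log g ≤ E g - 1`. -/
theorem expect_mul_log_le_sub_one (m g : α → ℝ) (hm : ∀ a, 0 ≤ m a) (h1 : 𝔼 a, m a = 1)
    (hg : ∀ a, 0 < m a → 0 < g a) :
    𝔼 a, m a * Real.log (g a) ≤ 𝔼 a, m a * g a - 1 := by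
  rw [← h1, ← expect_sub_distrib]
  refine expect_le_expect fun a _ => ?_
  rcases (hm a).eq_or_lt with h | h
  · simp [← h]
  · nlinarith [Real.log_le_sub_one_of_pos (hg a h)]

theorem expect_density_mul_pos (m g : α → ℝ) (hm : ∀ a, 0 ≤ m a) (h1 : 𝔼 a, m a = 1)
    (hg : ∀ a, 0 < m a → 0 < g a) : 0 < 𝔼 a, m a * g a := by
  have : ∃ a ∈ univ, m a ≠ 0 := exists_ne_zero_of_expect_ne_zero (by rw [h1]; exact one_ne_zero)
  obtain ⟨a, -, ha⟩ := this
  have ha' : 0 < m a := lt_of_le_of_ne (hm a) ha.symm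
  refine expect_pos' (fun b _ => ?_) ⟨a, mem_univ _, mul_pos ha' (hg a ha')⟩
  rcases (hm b).eq_or_lt with h | h
  · simp [← h]
  · exact (mul_pos h (hg b h)).le

/-- Jensen's inequality for the logarithm with respect to a probability density. -/
theorem expect_mul_log_le_log (m g : α → ℝ) (hm : ∀ a, 0 ≤ m a) (h1 : 𝔼 a, m a = 1)
    (hg : ∀ a, 0 < m a → 0 < g a) :
    𝔼 a, m a * Real.log (g a) ≤ Real.log (𝔼 a, m a * g a) := by
  set c := 𝔼 a, m a * g a with hc
  have hcpos : 0 < c := expect_density_mul_pos m g hm h1 hg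
  have h := expect_mul_log_le_sub_one m (fun a => g a / c) hm h1
    (fun a ha => div_pos (hg a ha) hcpos)
  have e1 : 𝔼 a, m a * (g a / c) = 1 := by
    simp only [← mul_div_assoc]
    rw [← expect_div, ← hc, div_self hcpos.ne']
  have e2 : 𝔼 a, m a * Real.log (g a / c) = 𝔼 a, m a * Real.log (g a) - Real.log c := by
    rw [← one_mul (Real.log c), ← h1, expect_mul, ← expect_sub_distrib]
    refine expect_congr rfl fun a _ => ?_
    rcases (hm a).eq_or_lt with h | h
    · simp [← h]
    · rw [Real.log_div (hg a h).ne' hcpos.ne']; ring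
  rw [e1, e2] at h
  linarith

theorem sub_one_le_mul_log {t : ℝ} (ht : 0 ≤ t) : t - 1 ≤ t * Real.log t := by
  rcases ht.eq_or_lt with rfl | h
  · simp
  · have := Real.one_sub_inv_le_log_of_pos h
    have h2 := mul_le_mul_of_nonneg_left this ht
    rwa [mul_sub, mul_one, mul_inv_cancel₀ h.ne'] at h2

theorem expect_mul_log_self_nonneg (q : α → ℝ) (hq : ∀ a, 0 ≤ q a) (h1 : 𝔼 a, q a = 1)
    [Nonempty α] : 0 ≤ 𝔼 a, q a * Real.log (q a) := by
  have : 𝔼 a, (q a - 1) = 0 := by rw [expect_sub_distrib, h1, Fintype.expect_const]; simp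
  rw [← this]
  exact expect_le_expect fun a _ => sub_one_le_mul_log (hq a)

/-- With s = √t, multiplying s - 1 ≤ s log s by 2s gives 2t - 2s ≤ t log t. This is the pointwise
form of the bound of Hellinger distance by relative entropy. -/
theorem sq_sqrt_sub_one_le {t : ℝ} (ht : 0 ≤ t) :
    (√t - 1) ^ 2 ≤ t * Real.log t - t + 1 := by
  have hs := Real.sqrt_nonneg t
  have h := mul_le_mul_of_nonneg_left (sub_one_le_mul_log hs) hs
  have hl : Real.log t = 2 * Real.log √t := by rw [Real.log_sqrt ht]; ring
  have hsq := Real.sq_sqrt ht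
  have ht' : t * (2 * Real.log √t) = 2 * (√t * (√t * Real.log √t)) := by
    rw [← mul_assoc √t, ← sq √t, hsq]; ring
  rw [hl, ht']
  nlinarith

/-- A Pinsker-type bound: the `L¹` distance of a density from `1` in terms of its relative
entropy. -/
theorem expect_abs_sub_one_le [Nonempty α] (q : α → ℝ) (hq : ∀ a, 0 ≤ q a)
    (h1 : 𝔼 a, q a = 1) :
    𝔼 a, |q a - 1| ≤ 2 * √(𝔼 a, q a * Real.log (q a)) := by
  set D := 𝔼 a, q a * Real.log (q a) with hD
  -- Cauchy–Schwarz for |q - 1| = |√q - 1| (√q + 1). The second factor has mean square at most 4,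
  -- because (√q + 1)² ≤ 2q + 2.
  have hcs := expect_mul_sq_le_sq_mul_sq univ (fun a => |√(q a) - 1|) (fun a => √(q a) + 1)
  have e1 : ∀ a, |√(q a) - 1| * (√(q a) + 1) = |q a - 1| := by
    intro a
    have hs := Real.sqrt_nonneg (q a)
    have hf : q a - 1 = (√(q a) - 1) * (√(q a) + 1) := by linarith [Real.mul_self_sqrt (hq a)]
    rw [hf, abs_mul, abs_of_nonneg (by linarith : 0 ≤ √(q a) + 1)]
  have e2 : 𝔼 a, |√(q a) - 1| ^ 2 ≤ D := by
    have : D = 𝔼 a, (q a * Real.log (q a) - q a + 1) := by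
      rw [expect_add_distrib, expect_sub_distrib, h1, Fintype.expect_const]; simp [hD]
    rw [this]
    refine expect_le_expect fun a _ => ?_
    rw [sq_abs]
    exact sq_sqrt_sub_one_le (hq a)
  have e3 : 𝔼 a, (√(q a) + 1) ^ 2 ≤ 4 := by
    have : (4 : ℝ) = 𝔼 a, (2 * q a + 2) := by
      rw [expect_add_distrib, ← mul_expect, h1, Fintype.expect_const]; norm_num
    rw [this]
    refine expect_le_expect fun a _ => ?_
    nlinarith [Real.sq_sqrt (hq a), sq_nonneg (√(q a) - 1)]
  simp only [e1] at hcs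
  have hD0 : 0 ≤ D := expect_mul_log_self_nonneg q hq h1
  have hle : (𝔼 a, |q a - 1|) ^ 2 ≤ D * 4 :=
    hcs.trans (mul_le_mul e2 e3 (expect_nonneg fun a _ => sq_nonneg _) hD0)
  refine abs_le_of_sq_le_sq' ?_ (by positivity) |>.2
  rw [mul_pow, Real.sq_sqrt hD0]
  linarith

end Averages

/-! ### The random star and its marginals -/

section StarMeasure

variable {J V : Type*} [Fintype V]

/-- The normalized degree of `v`. -/
noncomputable def rowMean (A : V → V → ℝ) (v : V) : ℝ := 𝔼 y, A v y

/-- The edge density of the kernel `A`. -/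
noncomputable def edgeMean (A : V → V → ℝ) : ℝ := 𝔼 v, rowMean A v

/-- The normalized number of common neighbours of the vertices `x j`, `j ∈ S`. -/
noncomputable def codegree (A : V → V → ℝ) (S : Finset J) (x : J → V) : ℝ :=
  𝔼 v, ∏ j ∈ S, A v (x j)

/-- The density (with respect to the uniform distribution) of a random star: the centre `v` is
chosen proportionally to its degree, the leaves `x j`, `j ∈ S`, independently among the
neighbours of `v`. -/
noncomputable def starDensity (A : V → V → ℝ) (S : Finset J) (v : V) (x : J → V) : ℝ :=
  rowMean A v / edgeMean A * ∏ j ∈ S, A v (x j) / rowMean A v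

/-- The density of the leaves of a random star. -/
noncomputable def leafDensity (A : V → V → ℝ) (S : Finset J) (x : J → V) : ℝ :=
  𝔼 v, starDensity A S v x

variable {A : V → V → ℝ} (hA : ∀ v y, 0 ≤ A v y) (hp : 0 < edgeMean A)

include hA in
theorem rowMean_nonneg (v : V) : 0 ≤ rowMean A v := expect_nonneg fun y _ => hA v y

include hA hp in
theorem starDensity_nonneg (S : Finset J) (v : V) (x : J → V) : 0 ≤ starDensity A S v x :=
  mul_nonneg (div_nonneg (rowMean_nonneg hA v) hp.le)
    (prod_nonneg fun _ _ => div_nonneg (hA _ _) (rowMean_nonneg hA v))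

include hA hp in
theorem leafDensity_nonneg (S : Finset J) (x : J → V) : 0 ≤ leafDensity A S x :=
  expect_nonneg fun v _ => starDensity_nonneg hA hp S v x

include hA in
theorem codegree_nonneg (S : Finset J) (x : J → V) : 0 ≤ codegree A S x :=
  expect_nonneg fun _ _ => prod_nonneg fun _ _ => hA _ _

include hp in
theorem nonempty_of_edgeMean_pos : Nonempty V := by
  by_contra h
  rw [not_nonempty_iff] at h
  simp [edgeMean] at hp

theorem dependsOn_codegree (S : Finset J) :
    DependsOn (fun x : J → V => codegree A S x) (S : Set J) := fun x y h =>
  expect_congr rfl fun v _ => prod_congr rfl fun j hj => by rw [h j (mem_coe.2 hj)]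

theorem dependsOn_leafDensity (S : Finset J) :
    DependsOn (fun x : J → V => leafDensity A S x) (S : Set J) := fun x y h =>
  expect_congr rfl fun v _ => by
    unfold starDensity
    congr 1
    exact prod_congr rfl fun j hj => by rw [h j (mem_coe.2 hj)]

include hA hp in
-- The change of measure from the star to uniform sampling. It is an equality when the degree is
-- positive; at degree 0 the left side vanishes by the convention for division. Writing d^#S / d
-- instead of d^(#S - 1) keeps the empty set included.
theorem starDensity_mul_le (S : Finset J) (v : V) (x : J → V) :
    starDensity A S v x * (edgeMean A * rowMean A v ^ #S / rowMean A v)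
      ≤ ∏ j ∈ S, A v (x j) := by
  rcases (rowMean_nonneg hA v).eq_or_lt with h | h
  · rw [← h, div_zero, mul_zero]
    exact prod_nonneg fun _ _ => hA _ _
  · have h1 := h.ne'
    have h2 := hp.ne'
    unfold starDensity
    rw [prod_div_distrib, prod_const]
    apply le_of_eq
    field_simp

variable [Fintype J]

include hA in
-- On the support of the star every quantity whose logarithm is taken is positive, so the junk value
-- of log 0 never matters.
theorem pos_of_starDensity_pos {v : V} {x : J → V}
    (h : 0 < starDensity A univ v x) : 0 < rowMean A v ∧ ∀ j, 0 < A v (x j) := by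
  have h1 : 0 < rowMean A v := by
    refine lt_of_le_of_ne (rowMean_nonneg hA v) fun h0 => ?_
    simp [starDensity, ← h0] at h
  refine ⟨h1, fun j => lt_of_le_of_ne (hA _ _) fun h0 => ?_⟩
  have : ∏ j, A v (x j) / rowMean A v = 0 :=
    prod_eq_zero (mem_univ j) (by rw [← h0, zero_div])
  simp [starDensity, this] at h

include hA in
theorem codegree_pos {v : V} {x : J → V}
    (h : 0 < starDensity A univ v x) (S : Finset J) : 0 < codegree A S x :=
  expect_pos' (fun _ _ => prod_nonneg fun _ _ => hA _ _)
    ⟨v, mem_univ _, prod_pos fun j _ => (pos_of_starDensity_pos hA h).2 j⟩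

include hA hp in
theorem leafDensity_pos {v : V} {x : J → V}
    (h : 0 < starDensity A univ v x) (S : Finset J) : 0 < leafDensity A S x := by
  obtain ⟨h1, h2⟩ := pos_of_starDensity_pos hA h
  exact expect_pos' (fun w _ => starDensity_nonneg hA hp S w x)
    ⟨v, mem_univ _, mul_pos (div_pos h1 hp) (prod_pos fun j _ => div_pos (h2 j) h1)⟩

variable [DecidableEq J]

include hp in
/-- Marginalization of the random star. -/
theorem expect_starDensity_univ_mul (S : Finset J) (v : V) (g : (J → V) → ℝ)
    (hg : DependsOn g (S : Set J)) :
    𝔼 x, starDensity A univ v x * g x = 𝔼 x, starDensity A S v x * g x := by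
  have := nonempty_of_edgeMean_pos hp
  by_cases h0 : rowMean A v = 0
  · simp [starDensity, h0]
  have hc : 𝔼 y, A v y / rowMean A v = 1 := by
    rw [← expect_div]; exact div_self h0
  have hd : DependsOn (fun x : J → V => starDensity A S v x * g x) (S : Set J) := by
    intro x y hxy
    have h1 : g x = g y := hg hxy
    have h2 : ∏ j ∈ S, A v (x j) / rowMean A v = ∏ j ∈ S, A v (y j) / rowMean A v :=
      prod_congr rfl fun j hj => by rw [hxy j (mem_coe.2 hj)]
    simp only [starDensity, h1, h2]
  -- Given the centre, each leaf outside `S` has a density of mean 1 and integrates out.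
  rw [← expect_prod_mul_of_dependsOn (fun y => A v y / rowMean A v) hc S _ hd Sᶜ
    disjoint_compl_right]
  refine expect_congr rfl fun x _ => ?_
  unfold starDensity
  rw [← prod_mul_prod_compl S]
  ring

include hp in
theorem expect_starDensity (S : Finset J) (v : V) :
    𝔼 x : J → V, starDensity A S v x = rowMean A v / edgeMean A := by
  have := nonempty_of_edgeMean_pos hp
  have h1 := expect_starDensity_univ_mul hp S v (fun _ => 1) (fun _ _ _ => rfl)
  have h2 := expect_starDensity_univ_mul (J := J) hp ∅ v (fun _ => 1) (fun _ _ _ => rfl)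
  rw [h2] at h1
  simpa [starDensity] using h1.symm

include hp in
theorem expect_rowMean_div : 𝔼 v, rowMean A v / edgeMean A = 1 := by
  rw [← expect_div]; exact div_self hp.ne'

include hp in
theorem expect_leafDensity (S : Finset J) : 𝔼 x : J → V, leafDensity A S x = 1 := by
  unfold leafDensity
  rw [expect_comm]
  simp only [expect_starDensity hp]
  exact expect_rowMean_div hp

include hp in
theorem expect_leafDensity_univ_mul (S : Finset J) (g : (J → V) → ℝ)
    (hg : DependsOn g (S : Set J)) :
    𝔼 x, leafDensity A univ x * g x = 𝔼 x, leafDensity A S x * g x := by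
  unfold leafDensity
  simp only [expect_mul]
  rw [expect_comm, expect_comm (f := fun x v => starDensity A S v x * g x)]
  exact expect_congr rfl fun v _ => expect_starDensity_univ_mul hp S v g hg

include hp in
theorem expect_star_mul_leaf (S : Finset J) (g : (J → V) → ℝ) (hg : DependsOn g (S : Set J)) :
    𝔼 z : V × (J → V), starDensity A univ z.1 z.2 * g z.2 = 𝔼 x, leafDensity A S x * g x := by
  rw [← expect_leafDensity_univ_mul hp S g hg, ← univ_product_univ, expect_product, expect_comm]
  exact expect_congr rfl fun x _ => by rw [leafDensity, expect_mul]

include hp in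
theorem expect_star_mul_centre (k : V → ℝ) :
    𝔼 z : V × (J → V), starDensity A univ z.1 z.2 * k z.1
      = 𝔼 v, rowMean A v / edgeMean A * k v := by
  rw [← univ_product_univ, expect_product]
  refine expect_congr rfl fun v _ => ?_
  dsimp only
  rw [← expect_mul, expect_starDensity hp]

include hp in
theorem expect_star : 𝔼 z : V × (J → V), starDensity A univ z.1 z.2 = 1 := by
  have := expect_star_mul_centre (J := J) hp fun _ => 1
  simpa [expect_rowMean_div hp] using this

include hp in
theorem expect_star_mul_const (c : ℝ) :
    𝔼 z : V × (J → V), starDensity A univ z.1 z.2 * c = c := by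
  rw [← expect_mul, expect_star hp, one_mul]

/-! ### Entropy bounds for codegrees and for the density of H -/

/-- The relative entropy of the degree-biased vertex distribution. -/
noncomputable def degreeEntropy (A : V → V → ℝ) : ℝ :=
  𝔼 v, rowMean A v / edgeMean A * Real.log (rowMean A v / edgeMean A)

/-- The relative entropy of the leaves of a random star. -/
noncomputable def leafEntropy (A : V → V → ℝ) (S : Finset J) : ℝ :=
  𝔼 x : J → V, leafDensity A S x * Real.log (leafDensity A S x)

include hA hp in
theorem degreeEntropy_nonneg : 0 ≤ degreeEntropy A := by
  have := nonempty_of_edgeMean_pos hp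
  exact expect_mul_log_self_nonneg _ (fun v => div_nonneg (rowMean_nonneg hA v) hp.le)
    (expect_rowMean_div hp)

include hA hp in
theorem leafEntropy_nonneg (S : Finset J) : 0 ≤ leafEntropy A S := by
  have := nonempty_of_edgeMean_pos hp
  exact expect_mul_log_self_nonneg _ (leafDensity_nonneg hA hp S) (expect_leafDensity hp S)

include hA hp in
theorem expect_star_mul_log_rowMean :
    𝔼 z : V × (J → V), starDensity A univ z.1 z.2 * Real.log (rowMean A z.1)
      = Real.log (edgeMean A) + degreeEntropy A := by
  rw [expect_star_mul_centre hp (fun v => Real.log (rowMean A v)),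
    ← one_mul (Real.log (edgeMean A)), ← expect_rowMean_div hp, expect_mul, degreeEntropy,
    ← expect_add_distrib]
  refine expect_congr rfl fun v _ => ?_
  rcases (rowMean_nonneg hA v).eq_or_lt with h | h
  · simp [← h]
  · rw [Real.log_div h.ne' hp.ne']; ring

include hp in
theorem expect_star_mul_log_leafDensity (S : Finset J) :
    𝔼 z : V × (J → V), starDensity A univ z.1 z.2 * Real.log (leafDensity A S z.2)
      = leafEntropy A S :=
  expect_star_mul_leaf hp S (fun x => Real.log (leafDensity A S x))
    fun _ _ h => congrArg Real.log (dependsOn_leafDensity S h)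

include hA hp in
/-- The expected logarithm of the codegree of the leaves of a random star. -/
theorem le_expect_star_mul_log_codegree (S : Finset J) (hS : S.Nonempty) :
    #S * Real.log (edgeMean A) + leafEntropy A S ≤
      𝔼 z : V × (J → V), starDensity A univ z.1 z.2 * Real.log (codegree A S z.2) := by
  have := nonempty_of_edgeMean_pos hp
  set p := edgeMean A with hpdef
  have hm : ∀ z : V × (J → V), 0 ≤ starDensity A univ z.1 z.2 := fun z =>
    starDensity_nonneg hA hp _ _ _
  -- The test function is a likelihood ratio: the competing law keeps the leaves in `S` but
  -- resamples the centre uniformly among their common neighbours. Its star expectation is at most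
  -- 1, so the expected logarithm is at most 0.
  have hgibbs := expect_mul_log_le_sub_one (fun z : V × (J → V) => starDensity A univ z.1 z.2)
    (fun z => p * rowMean A z.1 ^ #S / rowMean A z.1 *
      (leafDensity A S z.2 / codegree A S z.2)) hm (expect_star hp) (fun z hz => by
        obtain ⟨h1, h2⟩ := pos_of_starDensity_pos hA hz
        have h3 := codegree_pos hA hz S
        have h4 := leafDensity_pos hA hp hz S
        positivity)
  have hle : 𝔼 z : V × (J → V), starDensity A univ z.1 z.2 *
      (p * rowMean A z.1 ^ #S / rowMean A z.1 * (leafDensity A S z.2 / codegree A S z.2))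
      ≤ 1 := by
    have hdep : DependsOn (fun x : J → V => leafDensity A S x / codegree A S x) (S : Set J) :=
      fun x y h => congrArg₂ (· / ·) (dependsOn_leafDensity S h) (dependsOn_codegree S h)
    have hratio : ∀ x : J → V, 0 ≤ leafDensity A S x / codegree A S x := fun x =>
      div_nonneg (leafDensity_nonneg hA hp S x) (codegree_nonneg hA S x)
    calc _ = 𝔼 v, (p * rowMean A v ^ #S / rowMean A v) * 𝔼 x : J → V, starDensity A univ v x *
            (leafDensity A S x / codegree A S x) := by
          rw [← univ_product_univ, expect_product]
          refine expect_congr rfl fun v _ => ?_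
          rw [mul_expect]
          exact expect_congr rfl fun x _ => by ring
      _ = 𝔼 v, 𝔼 x : J → V, (starDensity A S v x * (p * rowMean A v ^ #S / rowMean A v)) *
            (leafDensity A S x / codegree A S x) := by
          refine expect_congr rfl fun v _ => ?_
          rw [expect_starDensity_univ_mul hp S v _ hdep, mul_expect]
          exact expect_congr rfl fun x _ => by ring
      _ ≤ 𝔼 v, 𝔼 x : J → V, (∏ j ∈ S, A v (x j)) * (leafDensity A S x / codegree A S x) :=
          expect_le_expect fun v _ => expect_le_expect fun x _ =>
            mul_le_mul_of_nonneg_right (starDensity_mul_le hA hp S v x) (hratio x)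
      _ = 𝔼 x : J → V, codegree A S x * (leafDensity A S x / codegree A S x) := by
          rw [expect_comm]
          exact expect_congr rfl fun x _ => by rw [codegree, expect_mul]
      _ ≤ 𝔼 x : J → V, leafDensity A S x := by
          refine expect_le_expect fun x _ => ?_
          rcases (codegree_nonneg hA S x).eq_or_lt with h | h
          · rw [← h, zero_mul]; exact leafDensity_nonneg hA hp S x
          · rw [mul_div_cancel₀ _ h.ne']
      _ = 1 := expect_leafDensity hp S
  have hsplit : 𝔼 z : V × (J → V), starDensity A univ z.1 z.2 *
      Real.log (p * rowMean A z.1 ^ #S / rowMean A z.1 *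
        (leafDensity A S z.2 / codegree A S z.2))
      = Real.log p + (#S - 1) * (Real.log p + degreeEntropy A) + leafEntropy A S -
        𝔼 z : V × (J → V), starDensity A univ z.1 z.2 * Real.log (codegree A S z.2) := by
    rw [← expect_star_mul_log_rowMean (J := J) hA hp, ← expect_star_mul_log_leafDensity hp S,
      mul_expect, ← expect_star_mul_const (J := J) hp (Real.log p),
      ← expect_add_distrib, ← expect_add_distrib, ← expect_sub_distrib]
    refine expect_congr rfl fun z _ => ?_
    rcases (hm z).eq_or_lt with h | h
    · simp [← h]
    · obtain ⟨h1, h2⟩ := pos_of_starDensity_pos hA h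
      have h3 := codegree_pos hA h S
      have h4 := leafDensity_pos hA hp h S
      rw [Real.log_mul (by positivity) (by positivity), Real.log_div (by positivity) h1.ne',
        Real.log_mul hp.ne' (by positivity), Real.log_pow, Real.log_div h4.ne' h3.ne']
      ring
  rw [hsplit] at hgibbs
  have hcard : (1 : ℝ) ≤ #S := by exact_mod_cast hS.card_pos
  -- The nonnegative term (#S - 1) · `degreeEntropy A` is discarded.
  nlinarith [mul_nonneg (sub_nonneg.2 hcard) (degreeEntropy_nonneg hA hp)]

include hA hp in
theorem card_mul_log_le_expect_star_mul_log_codegree (S : Finset J) :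
    #S * Real.log (edgeMean A) ≤
      𝔼 z : V × (J → V), starDensity A univ z.1 z.2 * Real.log (codegree A S z.2) := by
  rcases S.eq_empty_or_nonempty with rfl | hS
  · have := nonempty_of_edgeMean_pos hp
    simp [codegree]
  · linarith [le_expect_star_mul_log_codegree hA hp S hS, leafEntropy_nonneg hA hp S]

include hA hp in
/-- The entropy form of Sidorenko's inequality for a bipartite graph in which two vertices `a`,
`b` of the part `I` are complete to the part `J`; the neighbourhood of `i : I` is `N i`. -/
theorem entropy_le_log_expect_prod_codegree {I : Type*} [Fintype I] [DecidableEq I]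
    (N : I → Finset J) {a b : I} (hab : a ≠ b) (ha : N a = univ) (hb : N b = univ)
    (hJ : 2 ≤ Fintype.card J) :
    0 < 𝔼 x : J → V, ∏ i, codegree A (N i) x ∧
    (∑ i, #(N i) : ℕ) * Real.log (edgeMean A) + degreeEntropy A + leafEntropy A (univ : Finset J) ≤
      Real.log (𝔼 x : J → V, ∏ i, codegree A (N i) x) := by
  have := nonempty_of_edgeMean_pos hp
  set p := edgeMean A with hpdef
  set k := Fintype.card J with hk
  have hm : ∀ z : V × (J → V), 0 ≤ starDensity A univ z.1 z.2 := fun z =>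
    starDensity_nonneg hA hp _ _ _
  -- The vertex `a` serves as the centre of the star: the first factor undoes the star density, and
  -- the codegrees of the other vertices remain.
  set g : V × (J → V) → ℝ := fun z => p * rowMean A z.1 ^ k / rowMean A z.1 *
    ∏ i ∈ univ.erase a, codegree A (N i) z.2 with hg
  have hgpos : ∀ z, 0 < starDensity A univ z.1 z.2 → 0 < g z := fun z hz => by
    obtain ⟨h1, h2⟩ := pos_of_starDensity_pos hA hz
    have h3 : 0 < ∏ i ∈ univ.erase a, codegree A (N i) z.2 :=
      prod_pos fun i _ => codegree_pos hA hz (N i)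
    positivity
  have hpos := expect_density_mul_pos _ g hm (expect_star hp) hgpos
  have hjensen := expect_mul_log_le_log _ g hm (expect_star hp) hgpos
  have hle : 𝔼 z : V × (J → V), starDensity A univ z.1 z.2 * g z
      ≤ 𝔼 x : J → V, ∏ i, codegree A (N i) x := by
    rw [← univ_product_univ, expect_product, expect_comm]
    refine expect_le_expect fun x _ => ?_
    rw [← mul_prod_erase univ _ (mem_univ a), ha, codegree, expect_mul]
    refine expect_le_expect fun v _ => ?_
    rw [hg, ← mul_assoc]
    exact mul_le_mul_of_nonneg_right (starDensity_mul_le hA hp univ v x)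
      (prod_nonneg fun i _ => codegree_nonneg hA _ _)
  refine ⟨hpos.trans_le hle, le_trans ?_ (hjensen.trans (Real.log_le_log hpos hle))⟩
  have hsplit : 𝔼 z : V × (J → V), starDensity A univ z.1 z.2 * Real.log (g z)
      = Real.log p + (k - 1) * (Real.log p + degreeEntropy A) +
        ∑ i ∈ univ.erase a, 𝔼 z : V × (J → V),
          starDensity A univ z.1 z.2 * Real.log (codegree A (N i) z.2) := by
    rw [← expect_star_mul_log_rowMean (J := J) hA hp, ← expect_sum_comm,
      mul_expect, ← expect_star_mul_const (J := J) hp (Real.log p),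
      ← expect_add_distrib, ← expect_add_distrib]
    refine expect_congr rfl fun z _ => ?_
    rcases (hm z).eq_or_lt with h | h
    · simp [← h]
    · obtain ⟨h1, h2⟩ := pos_of_starDensity_pos hA h
      have h3 : ∀ i ∈ univ.erase a, codegree A (N i) z.2 ≠ 0 := fun i _ =>
        (codegree_pos hA h (N i)).ne'
      rw [hg, Real.log_mul (by positivity) (prod_ne_zero_iff.2 h3),
        Real.log_div (by positivity) h1.ne',
        Real.log_mul hp.ne' (by positivity), Real.log_pow, Real.log_prod h3, ← mul_sum]
      ring
  have hne : (univ : Finset J).Nonempty := by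
    rw [← card_pos, card_univ]; omega
  -- The vertex `b` supplies the entropy of the full set of leaves.
  have hfull := le_expect_star_mul_log_codegree hA hp (univ : Finset J) hne
  have hrest : ∑ i ∈ (univ.erase a).erase b, #(N i) * Real.log p ≤
      ∑ i ∈ (univ.erase a).erase b, 𝔼 z : V × (J → V),
          starDensity A univ z.1 z.2 * Real.log (codegree A (N i) z.2) :=
    sum_le_sum fun i _ => card_mul_log_le_expect_star_mul_log_codegree hA hp (N i)
  have hba : b ∈ univ.erase a := mem_erase.2 ⟨hab.symm, mem_univ _⟩
  rw [hsplit, ← add_sum_erase _ _ hba, hb]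
  push_cast
  rw [sum_mul, ← add_sum_erase _ _ (mem_univ a), ← add_sum_erase _ _ hba, ha, hb]
  rw [card_univ, ← hk] at hfull ⊢
  have hk2 : (2 : ℝ) ≤ k := by exact_mod_cast hJ
  -- The degree entropy occurs with coefficient k - 1, which is at least 1 as k ≥ 2.
  nlinarith [mul_nonneg (sub_nonneg.2 hk2) (degreeEntropy_nonneg hA hp)]

end StarMeasure

/-! ### From small entropy to codegrees, cut norm and subgraph counts -/

section Counting

variable {V : Type*} [Fintype V]

/-- The average absolute deviation `E_{y,z} |E_x U(x,y) U(x,z)|`, where `U = A - p`. -/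
noncomputable def codegreeDeviation (A : V → V → ℝ) (p : ℝ) : ℝ :=
  𝔼 y, 𝔼 z, |𝔼 x, (A x y - p) * (A x z - p)|

theorem expect_le_one {α : Type*} [Fintype α] (f : α → ℝ) (h : ∀ a, f a ≤ 1) :
    𝔼 a, f a ≤ 1 := by
  rcases isEmpty_or_nonempty α with h0 | h0
  · simp
  · exact expect_le univ_nonempty fun a _ => h a

/-- Passing to a marginal does not increase the `L¹` distance from `1`. -/
theorem expect_abs_leafDensity_sub_one_le {J : Type*} [Fintype J] [DecidableEq J]
    {A : V → V → ℝ} (hp : 0 < edgeMean A) (S : Finset J) :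
    𝔼 x : J → V, |leafDensity A S x - 1| ≤ 𝔼 x : J → V, |leafDensity A univ x - 1| := by
  -- This sign is the optimal test function for the marginal. It depends only on `S`, so the full
  -- density gives it the same expectation.
  set s : (J → V) → ℝ := fun x => SignType.sign (leafDensity A S x - 1) with hs
  have hdep : DependsOn s (S : Set J) := fun x y h => by
    have : leafDensity A S x = leafDensity A S y := dependsOn_leafDensity S h
    simp only [hs, this]
  have hmarg := expect_leafDensity_univ_mul hp S s hdep
  calc 𝔼 x : J → V, |leafDensity A S x - 1|
      = 𝔼 x : J → V, (leafDensity A S x * s x - s x) := by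
        refine expect_congr rfl fun x _ => ?_
        rw [← self_mul_sign]
        simp only [hs]
        ring
    _ = 𝔼 x : J → V, (leafDensity A univ x * s x - s x) := by
        rw [expect_sub_distrib, expect_sub_distrib, hmarg]
    _ ≤ 𝔼 x : J → V, |leafDensity A univ x - 1| := by
        refine expect_le_expect fun x _ => ?_
        have h1 : |s x| ≤ 1 := by
          simp only [hs]
          rcases lt_trichotomy (leafDensity A S x - 1) 0 with h | h | h
          · simp [sign_neg h]
          · simp [h]
          · simp [sign_pos h]
        calc leafDensity A univ x * s x - s x = (leafDensity A univ x - 1) * s x := by ring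
          _ ≤ |(leafDensity A univ x - 1) * s x| := le_abs_self _
          _ = |leafDensity A univ x - 1| * |s x| := abs_mul _ _
          _ ≤ |leafDensity A univ x - 1| := mul_le_of_le_one_right (abs_nonneg _) h1

/-- Small entropies force almost all codegrees to be close to those of a random graph. -/
theorem codegreeDeviation_le {J : Type*} [Fintype J] [DecidableEq J] {A : V → V → ℝ}
    (hA : ∀ v y, 0 ≤ A v y) (hA1 : ∀ v y, A v y ≤ 1) (hsymm : ∀ v y, A v y = A y v)
    (hp : 0 < edgeMean A) (hJ : 2 ≤ Fintype.card J) :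
    codegreeDeviation A (edgeMean A) ≤
      8 * √(degreeEntropy A + leafEntropy A (univ : Finset J)) := by
  have hV := nonempty_of_edgeMean_pos hp
  obtain ⟨i, j, hij⟩ := Fintype.exists_pair_of_one_lt_card (α := J) (by omega)
  have hD1 := degreeEntropy_nonneg hA hp
  have hD2 := leafEntropy_nonneg hA hp (univ : Finset J)
  set p := edgeMean A with hpdef
  set δ := √(degreeEntropy A + leafEntropy A (univ : Finset J)) with hδ
  have hδ0 : 0 ≤ δ := Real.sqrt_nonneg _
  have hd1 : ∀ v, rowMean A v ≤ 1 := fun v => expect_le_one _ (hA1 v)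
  have hp1 : p ≤ 1 := expect_le_one _ hd1
  have hd : ∀ v, |rowMean A v - p| = p * |rowMean A v / p - 1| := fun v => by
    rw [← abs_of_pos hp, ← abs_mul, abs_of_pos hp, mul_sub, mul_div_cancel₀ _ hp.ne', mul_one]
  have hdeg : 𝔼 v, |rowMean A v - p| ≤ 2 * δ := by
    have h := expect_abs_sub_one_le _ (fun v => div_nonneg (rowMean_nonneg hA v) hp.le)
      (expect_rowMean_div hp)
    calc 𝔼 v, |rowMean A v - p| = p * 𝔼 v, |rowMean A v / p - 1| := by
          rw [mul_expect]; exact expect_congr rfl fun v _ => hd v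
      _ ≤ 𝔼 v, |rowMean A v / p - 1| :=
          mul_le_of_le_one_left (expect_nonneg fun _ _ => abs_nonneg _) hp1
      _ ≤ 2 * √(degreeEntropy A) := h
      _ ≤ 2 * δ := by
          have := Real.sqrt_le_sqrt (by linarith :
            degreeEntropy A ≤ degreeEntropy A + leafEntropy A (univ : Finset J))
          linarith
  -- The joint density of two leaves; it would equal codegree / p² if all degrees were p.
  set r : V → V → ℝ := fun y z =>
    𝔼 v, rowMean A v / p * (A v y / rowMean A v * (A v z / rowMean A v)) with hr
  have hleaf : 𝔼 y, 𝔼 z, |r y z - 1| ≤ 2 * δ := by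
    rw [← expect_apply_pair hij]
    have hpair : ∀ x : J → V, r (x i) (x j) = leafDensity A {i, j} x := fun x =>
      expect_congr rfl fun v _ => by rw [starDensity, prod_pair hij]
    simp only [hpair]
    refine (expect_abs_leafDensity_sub_one_le hp {i, j}).trans ?_
    refine (expect_abs_sub_one_le _ (leafDensity_nonneg hA hp _)
      (expect_leafDensity hp _)).trans ?_
    have := Real.sqrt_le_sqrt (by linarith : leafEntropy A (univ : Finset J) ≤
      degreeEntropy A + leafEntropy A (univ : Finset J))
    rw [← hδ] at this
    unfold leafEntropy at this
    linarith
  -- The two sides differ by the weight 1 - p / d(v) on each `v`; averaging over `y` and `z`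
  -- produces d(v)², which clears the denominator and leaves d(v) |d(v) - p|.
  have hcod : 𝔼 y, 𝔼 z, |𝔼 v, A v y * A v z - p ^ 2 * r y z| ≤ 2 * δ := by
    calc 𝔼 y, 𝔼 z, |𝔼 v, A v y * A v z - p ^ 2 * r y z|
        ≤ 𝔼 y, 𝔼 z, 𝔼 v, A v y * A v z * |1 - p / rowMean A v| := by
          refine expect_le_expect fun y _ => expect_le_expect fun z _ => ?_
          rw [hr, mul_expect, ← expect_sub_distrib]
          refine (abs_expect_le _ _).trans (le_of_eq (expect_congr rfl fun v _ => ?_))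
          rw [← abs_of_nonneg (mul_nonneg (hA v y) (hA v z)), ← abs_mul,
            abs_of_nonneg (mul_nonneg (hA v y) (hA v z))]
          congr 1
          have := hp.ne'
          by_cases h0 : rowMean A v = 0
          · simp [h0]
          · field_simp
      _ = 𝔼 v, rowMean A v * |rowMean A v - p| := by
          have hsw : ∀ y, 𝔼 z, 𝔼 v, A v y * A v z * |1 - p / rowMean A v|
              = 𝔼 v, A v y * (rowMean A v * |1 - p / rowMean A v|) := fun y => by
            rw [expect_comm]
            refine expect_congr rfl fun v _ => ?_
            rw [← expect_mul, ← mul_expect, mul_assoc]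
            rfl
          simp only [hsw]
          rw [expect_comm]
          refine expect_congr rfl fun v _ => ?_
          rw [← expect_mul, ← rowMean]
          rcases (rowMean_nonneg hA v).eq_or_lt with h | h
          · simp [← h]
          · rw [← abs_of_pos h, ← abs_mul, abs_of_pos h, mul_sub, mul_one,
              mul_div_cancel₀ _ h.ne']
      _ ≤ 𝔼 v, |rowMean A v - p| := expect_le_expect fun v _ =>
          mul_le_of_le_one_left (abs_nonneg _) (hd1 v)
      _ ≤ 2 * δ := hdeg
  have hexp : ∀ y z, 𝔼 x, (A x y - p) * (A x z - p) =
      (𝔼 v, A v y * A v z - p ^ 2 * r y z) + p ^ 2 * (r y z - 1)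
        - p * (rowMean A y - p) - p * (rowMean A z - p) := fun y z => by
    have hcol : ∀ y, 𝔼 x, A x y = rowMean A y := fun y =>
      expect_congr rfl fun x _ => hsymm x y
    have : ∀ x, (A x y - p) * (A x z - p) = A x y * A x z - p * A x y - p * A x z + p ^ 2 :=
      fun x => by ring
    simp only [this]
    rw [expect_add_distrib, expect_sub_distrib, expect_sub_distrib, ← mul_expect, ← mul_expect,
      hcol, hcol, Fintype.expect_const]
    ring
  have hp2 : p ^ 2 ≤ 1 := pow_le_one₀ hp.le hp1
  calc codegreeDeviation A p
      ≤ 𝔼 y, 𝔼 z, (|𝔼 v, A v y * A v z - p ^ 2 * r y z| + |r y z - 1|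
          + |rowMean A y - p| + |rowMean A z - p|) := by
        refine expect_le_expect fun y _ => expect_le_expect fun z _ => ?_
        rw [hexp]
        refine (abs_sub _ _).trans (add_le_add ((abs_sub _ _).trans
          (add_le_add ((abs_add_le _ _).trans (add_le_add le_rfl ?_)) ?_)) ?_)
        · rw [abs_mul, abs_of_nonneg (sq_nonneg p)]
          exact mul_le_of_le_one_left (abs_nonneg _) hp2
        · rw [abs_mul, abs_of_pos hp]
          exact mul_le_of_le_one_left (abs_nonneg _) hp1
        · rw [abs_mul, abs_of_pos hp]
          exact mul_le_of_le_one_left (abs_nonneg _) hp1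
    _ = 𝔼 y, 𝔼 z, |𝔼 v, A v y * A v z - p ^ 2 * r y z| + 𝔼 y, 𝔼 z, |r y z - 1|
          + 𝔼 v, |rowMean A v - p| + 𝔼 v, |rowMean A v - p| := by
        simp only [expect_add_distrib, Fintype.expect_const]
    -- Four errors of at most 2δ each: codegree against `r`, `r` against 1, and two degree errors.
    _ ≤ 8 * δ := by linarith

/-- A cut-norm type estimate for `A - p` in terms of the codegree deviation. -/
theorem abs_expect_expect_mul_le (A : V → V → ℝ) (p : ℝ) (a b : V → ℝ)
    (ha : ∀ v, |a v| ≤ 1) (hb : ∀ v, |b v| ≤ 1) :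
    |𝔼 x, 𝔼 y, (A x y - p) * (a x * b y)| ≤ √(codegreeDeviation A p) := by
  apply Real.abs_le_sqrt
  have e1 : 𝔼 x, 𝔼 y, (A x y - p) * (a x * b y) = 𝔼 x, a x * 𝔼 y, (A x y - p) * b y :=
    expect_congr rfl fun x _ => by
      rw [mul_expect]; exact expect_congr rfl fun y _ => by ring
  rw [e1]
  -- Cauchy–Schwarz removes `a`; expanding the remaining square brings in codegrees, and absolute
  -- values then remove `b`.
  refine (expect_mul_sq_le_sq_mul_sq _ _ _).trans ?_
  have e2 : 𝔼 x, a x ^ 2 ≤ 1 := expect_le_one _ fun x => (sq_le_one_iff_abs_le_one _).2 (ha x)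
  refine (mul_le_of_le_one_left (expect_nonneg fun _ _ => sq_nonneg _) e2).trans ?_
  calc 𝔼 x, (𝔼 y, (A x y - p) * b y) ^ 2
      = 𝔼 x, 𝔼 y, 𝔼 z, b y * b z * ((A x y - p) * (A x z - p)) := by
        refine expect_congr rfl fun x _ => ?_
        rw [sq, expect_mul_expect]
        exact expect_congr rfl fun y _ => expect_congr rfl fun z _ => by ring
    _ = 𝔼 y, 𝔼 z, b y * b z * 𝔼 x, (A x y - p) * (A x z - p) := by
        rw [expect_comm]
        refine expect_congr rfl fun y _ => ?_
        rw [expect_comm]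
        exact expect_congr rfl fun z _ => by rw [mul_expect]
    _ ≤ codegreeDeviation A p := by
        refine expect_le_expect fun y _ => expect_le_expect fun z _ => ?_
        refine (le_abs_self _).trans ?_
        rw [abs_mul, abs_mul]
        exact mul_le_of_le_one_left (abs_nonneg _)
          (mul_le_one₀ (hb y) (abs_nonneg _) (hb z))

theorem abs_prod_le_one {ι : Type*} (s : Finset ι) (f : ι → ℝ) (h : ∀ i ∈ s, |f i| ≤ 1) :
    |∏ i ∈ s, f i| ≤ 1 := by
  rw [abs_prod]
  exact prod_le_one (fun _ _ => abs_nonneg _) h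

/-- Freeze all coordinates except `i` and `j`. No pair in `P` joins `i` to `j`, so each factor
involves at most one of them; the product splits as a(x_i) b(x_j) with both factors bounded by 1,
and the cut-norm estimate applies. -/
theorem abs_expect_sub_mul_prod_le {I : Type*} [Fintype I] [DecidableEq I] [Nonempty V]
    (A : V → V → ℝ) (hA : ∀ v y, |A v y| ≤ 1) (p : ℝ) (P : Finset (I × I)) {i j : I}
    (hij : i ≠ j) (h1 : (i, j) ∉ P) (h2 : (j, i) ∉ P) (hP : ∀ e ∈ P, e.1 ≠ e.2) :
    |𝔼 x : I → V, (A (x i) (x j) - p) * ∏ e ∈ P, A (x e.1) (x e.2)|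
      ≤ √(codegreeDeviation A p) := by
  rw [expect_eq_expect_update j, expect_eq_expect_update i]
  refine (abs_expect_le _ _).trans (expect_le univ_nonempty fun x _ => ?_)
  set Q : I × I → Prop := fun e => e.1 = j ∨ e.2 = j with hQ
  have hterm : ∀ y z, (A (update (update x i y) j z i) (update (update x i y) j z j) - p) *
      ∏ e ∈ P, A (update (update x i y) j z e.1) (update (update x i y) j z e.2)
      = (A y z - p) * ((∏ e ∈ P with ¬ Q e, A (update x i y e.1) (update x i y e.2)) *
        ∏ e ∈ P with Q e, A (update x j z e.1) (update x j z e.2)) := by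
    intro y z
    rw [update_of_ne hij, update_self, update_self, mul_comm (∏ e ∈ P with ¬ Q e, _),
      ← prod_filter_mul_prod_filter_not P Q]
    congr 2
    · refine prod_congr rfl fun e he => ?_
      obtain ⟨heP, heQ⟩ := mem_filter.1 he
      have hne : e.1 ≠ i ∧ e.2 ≠ i := by
        have := hP e heP
        obtain ⟨e1, e2⟩ := e
        constructor <;> rintro rfl <;> rcases heQ with rfl | rfl <;> simp_all
      rw [update_comm hij, update_of_ne hne.1, update_of_ne hne.2]
    · refine prod_congr rfl fun e he => ?_
      obtain ⟨heP, heQ⟩ := mem_filter.1 he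
      rw [hQ, not_or] at heQ
      rw [update_of_ne heQ.1, update_of_ne heQ.2]
  simp only [hterm]
  exact abs_expect_expect_mul_le A p
    (fun y => ∏ e ∈ P with ¬ Q e, A (update x i y e.1) (update x i y e.2))
    (fun z => ∏ e ∈ P with Q e, A (update x j z e.1) (update x j z e.2))
    (fun y => abs_prod_le_one _ _ fun e _ => hA _ _)
    (fun z => abs_prod_le_one _ _ fun e _ => hA _ _)

/-- The counting lemma. -/
theorem abs_expect_prod_sub_pow_le {I : Type*} [Fintype I] [DecidableEq I] [Nonempty V]
    (A : V → V → ℝ) (hA : ∀ v y, |A v y| ≤ 1) {p : ℝ} (hp : |p| ≤ 1) (P : Finset (I × I))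
    (hP : ∀ e ∈ P, e.1 ≠ e.2 ∧ e.swap ∉ P) :
    |𝔼 x : I → V, ∏ e ∈ P, A (x e.1) (x e.2) - p ^ #P| ≤ #P * √(codegreeDeviation A p) := by
  induction P using Finset.induction_on with
  | empty => simp
  | insert e P he ih =>
    have ih' := ih fun f hf => ⟨(hP f (mem_insert_of_mem hf)).1,
      fun h => (hP f (mem_insert_of_mem hf)).2 (mem_insert_of_mem h)⟩
    have hnew := abs_expect_sub_mul_prod_le A hA p P (hP e (mem_insert_self _ _)).1 he
      (fun h => (hP e (mem_insert_self _ _)).2 (mem_insert_of_mem h))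
      (fun f hf => (hP f (mem_insert_of_mem hf)).1)
    -- Telescoping: the factor of `e` is replaced by the constant `p`, at the cost of one cut-norm
    -- error.
    have hsplit : 𝔼 x : I → V, ∏ f ∈ insert e P, A (x f.1) (x f.2) - p ^ #(insert e P) =
        𝔼 x : I → V, (A (x e.1) (x e.2) - p) * ∏ f ∈ P, A (x f.1) (x f.2) +
        p * (𝔼 x : I → V, ∏ f ∈ P, A (x f.1) (x f.2) - p ^ #P) := by
      rw [card_insert_of_notMem he, mul_sub, mul_expect, add_sub, ← expect_add_distrib,
        pow_succ']
      congr 1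
      exact expect_congr rfl fun x _ => by rw [prod_insert he]; ring
    rw [hsplit, card_insert_of_notMem he]
    push_cast
    refine (abs_add_le _ _).trans ?_
    rw [abs_mul]
    have := mul_le_of_le_one_left (abs_nonneg
      (𝔼 x : I → V, ∏ f ∈ P, A (x f.1) (x f.2) - p ^ #P)) hp
    linarith

end Counting

/-! ### Homomorphism densities as averages of kernels -/

section HomDensity

open scoped Classical in
/-- The `0`-`1` adjacency kernel of a graph. -/
noncomputable def adjKernel {V : Type*} (G : SimpleGraph V) (x y : V) : ℝ :=
  if G.Adj x y then 1 else 0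

theorem adjKernel_nonneg {V : Type*} (G : SimpleGraph V) (x y : V) : 0 ≤ adjKernel G x y := by
  unfold adjKernel; split_ifs <;> norm_num

theorem adjKernel_le_one {V : Type*} (G : SimpleGraph V) (x y : V) : adjKernel G x y ≤ 1 := by
  unfold adjKernel; split_ifs <;> norm_num

theorem adjKernel_comm {V : Type*} (G : SimpleGraph V) (x y : V) :
    adjKernel G x y = adjKernel G y x := by
  classical
  unfold adjKernel
  exact if_congr (G.adj_comm x y) rfl rfl

/-- `P` contains each edge of `H` in exactly one of its two orientations. -/
def IsEdgeOrientation {W : Type*} (H : SimpleGraph W) (P : Finset (W × W)) : Prop :=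
  (∀ a b, H.Adj a b ↔ (a, b) ∈ P ∨ (b, a) ∈ P) ∧ ∀ e ∈ P, e.swap ∉ P

variable {W : Type u} {H : SimpleGraph W} {P : Finset (W × W)}

theorem IsEdgeOrientation.ncard_edgeSet (hP : IsEdgeOrientation H P) :
    H.edgeSet.ncard = #P := by
  have hset : H.edgeSet = (fun e : W × W => s(e.1, e.2)) '' (P : Set (W × W)) := by
    ext e
    induction e using Sym2.ind with
    | _ a b =>
      simp only [SimpleGraph.mem_edgeSet, hP.1 a b, Set.mem_image, mem_coe, Prod.exists, Sym2.eq_iff]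
      constructor
      · rintro (h | h)
        · exact ⟨a, b, h, Or.inl ⟨rfl, rfl⟩⟩
        · exact ⟨b, a, h, Or.inr ⟨rfl, rfl⟩⟩
      · rintro ⟨c, d, h, ⟨rfl, rfl⟩ | ⟨rfl, rfl⟩⟩
        · exact Or.inl h
        · exact Or.inr h
  rw [hset, Set.InjOn.ncard_image, Set.ncard_coe_finset]
  rintro ⟨a, b⟩ h ⟨c, d⟩ h' heq
  rcases Sym2.eq_iff.1 heq with ⟨h1, h2⟩ | ⟨h1, h2⟩
  · exact Prod.ext h1 h2
  · simp only at h1 h2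
    subst h1 h2
    exact absurd h' (hP.2 _ h)

variable [Fintype W]

theorem IsEdgeOrientation.homDensity_eq [DecidableEq W] (hP : IsEdgeOrientation H P)
    {V : Type v} [Fintype V] (G : SimpleGraph V) :
    homDensity H G = 𝔼 x : W → V, ∏ e ∈ P, adjKernel G (x e.1) (x e.2) := by
  classical
  let E : (H →g G) ≃ {x : W → V // ∀ e ∈ P, G.Adj (x e.1) (x e.2)} :=
    { toFun := fun f => ⟨f, fun e he => f.map_adj ((hP.1 _ _).2 (Or.inl he))⟩
      invFun := fun x => ⟨x.1, fun {a b} h => by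
        rcases (hP.1 a b).1 h with h | h
        · exact x.2 _ h
        · exact (x.2 _ h).symm⟩
      left_inv := fun f => rfl
      right_inv := fun x => rfl }
  rw [homDensity, Nat.card_congr E, Nat.card_eq_fintype_card, Fintype.card_subtype,
    Fintype.expect_eq_sum_div_card, Fintype.card_fun, Nat.cast_pow]
  congr 1
  simp only [adjKernel, prod_ite_zero, prod_const_one]
  rw [sum_boole]

theorem homDensity_top_fin_two {V : Type v} [Fintype V] (G : SimpleGraph V) :
    homDensity (⊤ : SimpleGraph (Fin 2)) G = edgeMean (adjKernel G) := by
  have hP : IsEdgeOrientation (⊤ : SimpleGraph (Fin 2)) {(0, 1)} := by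
    refine ⟨?_, ?_⟩
    · simp only [SimpleGraph.top_adj]
      decide
    · decide
  rw [hP.homDensity_eq]
  simp only [prod_singleton]
  rcases isEmpty_or_nonempty V with h | h
  · simp [edgeMean]
  · rw [expect_apply_pair (by decide : (0 : Fin 2) ≠ 1)]
    rfl

theorem ncard_edgeSet_top_fin_two : (⊤ : SimpleGraph (Fin 2)).edgeSet.ncard = 1 := by
  have hP : IsEdgeOrientation (⊤ : SimpleGraph (Fin 2)) {(0, 1)} := by
    refine ⟨?_, ?_⟩
    · simp only [SimpleGraph.top_adj]
      decide
    · decide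
  rw [hP.ncard_edgeSet, card_singleton]

theorem exists_isEdgeOrientation {k : ℕ} (F : SimpleGraph (Fin k)) :
    ∃ P, IsEdgeOrientation F P := by
  classical
  refine ⟨univ.filter fun e => e.1 < e.2 ∧ F.Adj e.1 e.2, fun a b => ?_, fun e he => ?_⟩
  · simp only [mem_filter, mem_univ, true_and]
    constructor
    · intro h
      rcases lt_or_gt_of_ne h.ne with h' | h'
      · exact Or.inl ⟨h', h⟩
      · exact Or.inr ⟨h', h.symm⟩
    · rintro (h | h)
      · exact h.2
      · exact h.2.symm
  · simp only [mem_filter, mem_univ, true_and, Prod.fst_swap, Prod.snd_swap] at he ⊢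
    exact fun h => lt_asymm h.1 he.1

theorem IsEdgeOrientation.abs_homDensity_sub_le [DecidableEq W] (hP : IsEdgeOrientation H P)
    {V : Type v} [Fintype V] [Nonempty V] (G : SimpleGraph V) {p : ℝ} (hp : |p| ≤ 1) :
    |homDensity H G - p ^ #P| ≤ #P * √(codegreeDeviation (adjKernel G) p) := by
  rw [hP.homDensity_eq]
  refine abs_expect_prod_sub_pow_le _ (fun x y => ?_) hp P fun e he => ⟨?_, hP.2 e he⟩
  · rw [abs_of_nonneg (adjKernel_nonneg G x y)]
    exact adjKernel_le_one G x y
  · exact ((hP.1 e.1 e.2).2 (Or.inl he)).ne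

theorem expect_prod_eq_prod_expect {I V : Type*} [Fintype I] [DecidableEq I] [Fintype V]
    (h : I → V → ℝ) : 𝔼 y : I → V, ∏ i, h i (y i) = ∏ i, 𝔼 v, h i v := by
  simp only [Fintype.expect_eq_sum_div_card]
  rw [prod_div_distrib, prod_const, card_univ, Fintype.card_fun, Nat.cast_pow,
    Fintype.prod_sum]

/-- The homomorphism density of a bipartite graph as an average of products of codegrees. -/
theorem homDensity_eq_expect_prod_codegree [DecidableEq W] (p : W → Prop) [DecidablePred p]
    (N : {w // ¬ p w} → Finset {w // p w})
    (hN : ∀ a b, H.Adj a b ↔ (∃ (ha : ¬ p a) (hb : p b), ⟨b, hb⟩ ∈ N ⟨a, ha⟩) ∨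
      ∃ (hb : ¬ p b) (ha : p a), ⟨a, ha⟩ ∈ N ⟨b, hb⟩) :
    H.edgeSet.ncard = ∑ i, #(N i) ∧ ∀ {V : Type v} [Fintype V] (G : SimpleGraph V),
      homDensity H G = 𝔼 x : {w // p w} → V, ∏ i, codegree (adjKernel G) (N i) x := by
  let ι : (Σ _ : {w // ¬ p w}, {w // p w}) ↪ W × W :=
    ⟨fun s => (s.1.1, s.2.1), by
      rintro ⟨⟨a, ha⟩, ⟨b, hb⟩⟩ ⟨⟨c, hc⟩, ⟨d, hd⟩⟩ h
      obtain ⟨rfl, rfl⟩ := Prod.mk.inj h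
      rfl⟩
  set P : Finset (W × W) := (univ.sigma N).map ι with hPdef
  have hmem : ∀ a b, (a, b) ∈ P ↔ ∃ (ha : ¬ p a) (hb : p b), ⟨b, hb⟩ ∈ N ⟨a, ha⟩ := by
    intro a b
    simp only [hPdef, Finset.mem_map, mem_sigma, mem_univ, true_and]
    constructor
    · rintro ⟨⟨⟨c, hc⟩, ⟨d, hd⟩⟩, h, heq⟩
      obtain ⟨rfl, rfl⟩ := Prod.mk.inj heq
      exact ⟨hc, hd, h⟩
    · rintro ⟨ha, hb, h⟩
      exact ⟨⟨⟨a, ha⟩, ⟨b, hb⟩⟩, h, rfl⟩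
  have hP : IsEdgeOrientation H P := by
    refine ⟨fun a b => by rw [hN, hmem, hmem], fun e he h => ?_⟩
    obtain ⟨h1, -, -⟩ := (hmem e.1 e.2).1 he
    obtain ⟨-, h2, -⟩ := (hmem e.2 e.1).1 h
    exact h1 h2
  refine ⟨by rw [hP.ncard_edgeSet, hPdef, card_map, card_sigma], fun {V} _ G => ?_⟩
  rw [hP.homDensity_eq, Fintype.expect_equiv (Equiv.piEquivPiSubtypeProd p fun _ => V) _
    (fun z => ∏ i, ∏ j ∈ N i, adjKernel G (z.2 i) (z.1 j))
    (fun x => by rw [hPdef, prod_map, prod_sigma]; rfl),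
    ← univ_product_univ, expect_product]
  exact expect_congr rfl fun x _ =>
    expect_prod_eq_prod_expect fun i v => ∏ j ∈ N i, adjKernel G v (x j)

end HomDensity

/-! ### Passage to sequences and the forcing theorem -/

theorem hasRandomDensity_iff_tendsto {W : Type u} [Fintype W] (H : SimpleGraph W)
    {V : ℕ → Type v} [∀ n, Fintype (V n)] (G : ∀ n, SimpleGraph (V n)) {p : ℝ} (hp : p ≠ 0) :
    HasRandomDensity H G p ↔
      Tendsto (fun n => homDensity H (G n)) atTop (nhds (p ^ H.edgeSet.ncard)) :=
  Asymptotics.isEquivalent_const_iff_tendsto (pow_ne_zero _ hp)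

/-- A sequence of graphs of edge density tending to `p` whose codegree deviation tends to `0` is
quasirandom. -/
theorem isQuasirandom_of_tendsto_codegreeDeviation {V : ℕ → Type v} [∀ n, Fintype (V n)]
    (G : ∀ n, SimpleGraph (V n)) {p : ℝ} (hp : 0 < p)
    (hedge : Tendsto (fun n => edgeMean (adjKernel (G n))) atTop (nhds p))
    (hdev : Tendsto (fun n => codegreeDeviation (adjKernel (G n)) (edgeMean (adjKernel (G n))))
      atTop (nhds 0)) : IsQuasirandom G p := by
  intro k F
  obtain ⟨P, hP⟩ := exists_isEdgeOrientation F
  rw [hasRandomDensity_iff_tendsto F G hp.ne', hP.ncard_edgeSet]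
  have hbound : Tendsto (fun n => (#P : ℝ) * √(codegreeDeviation (adjKernel (G n))
      (edgeMean (adjKernel (G n))))) atTop (nhds 0) := by
    simpa using hdev.sqrt.const_mul (#P : ℝ)
  have hdiff : Tendsto (fun n => homDensity F (G n) - edgeMean (adjKernel (G n)) ^ #P)
      atTop (nhds 0) := by
    refine squeeze_zero_norm' ?_ hbound
    filter_upwards [hedge.eventually (lt_mem_nhds hp)] with n hn
    have := nonempty_of_edgeMean_pos hn
    refine hP.abs_homDensity_sub_le (G n) ?_
    rw [abs_of_pos hn]
    exact expect_le_one _ fun v => expect_le_one _ fun y => adjKernel_le_one (G n) v y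
  simpa using hdiff.add (hedge.pow #P)

theorem theorem1p6 {W : Type u} [Fintype W] (H : SimpleGraph W) (V₁ V₂ : Set W)
    (hH : H.IsBipartiteWith V₁ V₂)
    (a b : W) (ha : a ∈ V₁) (hb : b ∈ V₁) (hab : a ≠ b)
    (ha_complete : ∀ w ∈ V₂, H.Adj a w) (hb_complete : ∀ w ∈ V₂, H.Adj b w)
    (hV₂ : 2 ≤ V₂.ncard) :
    IsForcing.{u, v} H := by
  classical
  intro p hp0 hp1 V _ G hK₂ hHG
  rw [hasRandomDensity_iff_tendsto _ G hp0.ne'] at hK₂ hHG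
  simp only [ncard_edgeSet_top_fin_two, pow_one, homDensity_top_fin_two] at hK₂
  have ha' : a ∉ V₂ := fun h => Set.disjoint_left.1 hH.disjoint ha h
  have hb' : b ∉ V₂ := fun h => Set.disjoint_left.1 hH.disjoint hb h
  let N : {w // ¬ w ∈ V₂} → Finset {w // w ∈ V₂} := fun i => univ.filter fun j => H.Adj i j
  obtain ⟨hcard, hdens⟩ := homDensity_eq_expect_prod_codegree.{u, v} (H := H) (· ∈ V₂) N
    (fun c d => by
      simp only [N, mem_filter, mem_univ, true_and, exists_prop]
      constructor
      · intro h
        rcases hH.mem_of_adj h with ⟨h1, h2⟩ | ⟨h1, h2⟩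
        · exact Or.inl ⟨fun h' => Set.disjoint_left.1 hH.disjoint h1 h', h2, h⟩
        · exact Or.inr ⟨fun h' => Set.disjoint_left.1 hH.disjoint h2 h', h1, h.symm⟩
      · rintro (⟨-, -, h⟩ | ⟨-, -, h⟩)
        · exact h
        · exact h.symm)
  have hJ : 2 ≤ Fintype.card {w // w ∈ V₂} := by
    rw [← Nat.card_eq_fintype_card]
    exact hV₂
  set e := H.edgeSet.ncard with he
  -- The Sidorenko deficit log t_H - e(H) log p_n, with p_n the actual edge density, tends to 0. It
  -- eventually dominates the sum of the two entropies.
  have hlim : Tendsto (fun n => 8 * √(Real.log (homDensity H (G n)) -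
      e * Real.log (edgeMean (adjKernel (G n))))) atTop (nhds 0) := by
    have h1 := (hHG.log (pow_ne_zero _ hp0.ne')).sub ((hK₂.log hp0.ne').const_mul (e : ℝ))
    rw [Real.log_pow, sub_self] at h1
    simpa using h1.sqrt.const_mul 8
  refine isQuasirandom_of_tendsto_codegreeDeviation G hp0 hK₂ ?_
  refine squeeze_zero_norm' ?_ hlim
  filter_upwards [hK₂.eventually (lt_mem_nhds hp0)] with n hn
  have hA := adjKernel_nonneg (G n)
  have hdev : 0 ≤ codegreeDeviation (adjKernel (G n)) (edgeMean (adjKernel (G n))) :=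
    expect_nonneg fun _ _ => expect_nonneg fun _ _ => abs_nonneg _
  rw [Real.norm_of_nonneg hdev]
  refine (codegreeDeviation_le hA (adjKernel_le_one (G n)) (adjKernel_comm (G n)) hn hJ).trans ?_
  have hent := (entropy_le_log_expect_prod_codegree hA hn N
    (a := ⟨a, ha'⟩) (b := ⟨b, hb'⟩) (fun h => hab (congrArg Subtype.val h))
    (by simpa [N, filter_eq_self] using ha_complete)
    (by simpa [N, filter_eq_self] using hb_complete) hJ).2
  rw [← hdens, ← hcard] at hent
  gcongr
  linarith
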